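/- A continuous-stage Runge--Kutta--Nyström (csRKN) method for second order problems $\ddot q=f(t,q)$, $q(t_0)=q_0$, $q'(t_0)=q_0'$ in $\mathbb R^d$ is given by coefficient functions $(\bar A_{\tau,\sigma},\bar B_\tau,B_\tau,C_\tau)$, $\tau,\sigma\in[0,1]$, through $$Q_\tau=q_0+hC_\tau q_0'+h^2\int_0^1\bar A_{\tau,\sigma}f(t_0+C_\sigma h,Q_\sigma)\,d\sigma,\qquad \tau\in[0,1],$$ $$q_1=q_0+hq_0'+h^2\int_0^1\bar B_\tau f(t_0+C_\tau h,Q_\tau)\,d\tau,\qquad q_1'=q_0'+h\int_0^1 B_\tau f(t_0+C_\tau h,Q_\tau)\,d\tau .$$ For non-negative integers $\eta,\zeta$ consider the conditions (for all $\tau,\sigma\in[0,1]$) $$\mathcal{CN}(\eta):\quad \int_0^1\bar A_{\tau,\sigma}C_\sigma^{\kappa-1}\,d\sigma=\frac{C_\tau^{\kappa+1}}{\kappa(\kappa+1)},\qquad 1\le\kappa\le\eta-1,$$ $$\mathcal{DN}(\zeta):\quad \int_0^1 B_\tau C_\tau^{\kappa-1}\bar A_{\tau,\sigma}\,d\tau=\frac{B_\sigma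 C_\sigma^{\kappa+1}}{\kappa(\kappa+1)}-\frac{B_\sigma C_\sigma}{\kappa}+\frac{B_\sigma}{\kappa+1},\qquad 1\le\kappa\le\zeta-1.$$ A quadrature formula $(b_i,c_i)_{i=1}^s$ on $[0,1]$ is of order $p$ if $\sum_{i=1}^s b_ig(c_i)=\int_0^1g(x)\,dx$ for all polynomials $g$ of degree at most $p-1$. An $s$-stage RKN method with coefficients $(\bar a_{ij},\bar b_i,b_i,c_i)$ is given by $$Q_i=q_0+hc_iq_0'+h^2\sum_{j=1}^s\bar a_{ij}f(t_0+c_jh,Q_j),\quad q_1=q_0+hq_0'+h^2\sum_{i=1}^s\bar b_if(t_0+c_ih,Q_i),\quad q_1'=q_0'+h\sum_{i=1}^s b_if(t_0+c_ih,Q_i).$$ It is of order at least $k$ if for every sufficiently smooth problem (that is, $f\in C^N$ near $(t_0,q_0)$, for some $N$ independent of the problem) the stage equations have, for small $h$, a solution with $Q_i\to q_0$ as $h\to0$, and every such solution gives $q(t_0+h)-q_1=\mathcal O(h^{k+1})$ and $q'(t_0+h)-q_1'=\mathcal O(h^{k+1})$ as $h\to0$. **Theorem.** Let a csRKN method satisfy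 $\bar B_\tau=B_\tau(1-C_\tau)$, $B_\tau=1$, $C_\tau=\tau$, and suppose that $\bar A_{\tau,\sigma}$ is a bivariate polynomial of degree $d^\tau$ in $\tau$ and of degree $d^\sigma$ in $\sigma$ and that both $\mathcal{CN}(\eta)$ and $\mathcal{DN}(\zeta)$ hold. Let $(b_i,c_i)_{i=1}^s$ be a quadrature formula of order $p$. (If some node lies outside $[0,1]$, the coefficient functions are extended to it by the same polynomials.) Then the $s$-stage RKN method with coefficients $\bar a_{ij}=b_j\bar A_{c_i,c_j}$, $\bar b_i=b_i(1-c_i)$, $b_i$, $c_i$ is of order at least $$\min(p,\,2\alpha+2,\,\alpha+\beta),\qquad \alpha=\min(\eta,\,p-d^\sigma+1),\quad \beta=\min(\zeta,\,p-d^\tau+1),$$ where a negative value is read as order $0$ (and the zero polynomial is given degrees $d^\tau=d^\sigma=0$). -/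

import Mathlib

open Filter Topology Asymptotics

/-- The coefficients of an `s`-stage Runge-Kutta-Nyström method for `q'' = f(t, q)`. -/
structure RKN (s : ℕ) where
  Abar : Matrix (Fin s) (Fin s) ℝ
  bbar : Fin s → ℝ
  b : Fin s → ℝ
  c : Fin s → ℝ

namespace RKN

variable {s : ℕ} {E : Type*} [NormedAddCommGroup E] [NormedSpace ℝ E]

/-- `Q` solves the stage equations with step size `h` and initial data `(t₀, q₀, v₀)`:
`Q i = q₀ + h cᵢ v₀ + h² ∑ⱼ āᵢⱼ f (t₀ + cⱼ h, Q j)`. -/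
def IsStages (M : RKN s) (f : ℝ → E → E) (t₀ : ℝ) (q₀ v₀ : E) (h : ℝ) (Q : Fin s → E) : Prop :=
  ∀ i, Q i = q₀ + (h * M.c i) • v₀ + h ^ 2 • ∑ j, M.Abar i j • f (t₀ + M.c j * h) (Q j)

/-- The new position `q₁` computed from the stages `Q`. -/
def nextPos (M : RKN s) (f : ℝ → E → E) (t₀ : ℝ) (q₀ v₀ : E) (h : ℝ) (Q : Fin s → E) : E :=
  q₀ + h • v₀ + h ^ 2 • ∑ i, M.bbar i • f (t₀ + M.c i * h) (Q i)

/-- The new velocity `q'₁` computed from the stages `Q`. -/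
def nextVel (M : RKN s) (f : ℝ → E → E) (t₀ : ℝ) (v₀ : E) (h : ℝ) (Q : Fin s → E) : E :=
  v₀ + h • ∑ i, M.b i • f (t₀ + M.c i * h) (Q i)

/-- The method may be implicit. A branch of stages `h ↦ Q h` solves the stage equations for all
sufficiently small `h`, with all the stages tending to `q₀` as `h → 0`. -/
def IsStageBranch (M : RKN s) (f : ℝ → E → E) (t₀ : ℝ) (q₀ v₀ : E) (Q : ℝ → Fin s → E) : Prop :=
  (∀ᶠ h in 𝓝 (0 : ℝ), M.IsStages f t₀ q₀ v₀ h (Q h)) ∧ ∀ i, Tendsto (fun h => Q h i) (𝓝 0) (𝓝 q₀)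

end RKN

/-- Near `t₀`, `q` solves `q'' = f(t, q)`, `q(t₀) = q₀`, `q'(t₀) = v₀`, and `v = q'`. -/
def IsLocalSolution {E : Type*} [NormedAddCommGroup E] [NormedSpace ℝ E]
    (f : ℝ → E → E) (t₀ : ℝ) (q₀ v₀ : E) (q v : ℝ → E) : Prop :=
  q t₀ = q₀ ∧ v t₀ = v₀ ∧
    ∀ᶠ t in 𝓝 t₀, HasDerivAt q (v t) t ∧ HasDerivAt v (f t (q t)) t

/-- The method is of order (at least) `k`: for every problem `q'' = f(t, q)` in `ℝ^d` that is
sufficiently smooth (`f` is of class `C^N` near the initial point, where `N` does not depend on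
the problem), the stage equations can be solved near `q₀` for small `h`, and whenever they are,
`q(t₀ + h) - q₁ = O(h^(k+1))` and `q'(t₀ + h) - q'₁ = O(h^(k+1))` as `h → 0`. -/
def RKN.HasOrder {s : ℕ} (M : RKN s) (k : ℕ) : Prop :=
  ∃ N : ℕ, ∀ (d : ℕ) (f : ℝ → EuclideanSpace ℝ (Fin d) → EuclideanSpace ℝ (Fin d))
    (t₀ : ℝ) (q₀ v₀ : EuclideanSpace ℝ (Fin d)) (q v : ℝ → EuclideanSpace ℝ (Fin d)),
    ContDiffAt ℝ (N : WithTop ℕ∞) (Function.uncurry f) (t₀, q₀) →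
    IsLocalSolution f t₀ q₀ v₀ q v →
    (∃ Q, M.IsStageBranch f t₀ q₀ v₀ Q) ∧
    ∀ Q, M.IsStageBranch f t₀ q₀ v₀ Q →
      (fun h : ℝ => q (t₀ + h) - M.nextPos f t₀ q₀ v₀ h (Q h)) =O[𝓝 0] (fun h => h ^ (k + 1)) ∧
      (fun h : ℝ => v (t₀ + h) - M.nextVel f t₀ v₀ h (Q h)) =O[𝓝 0] (fun h => h ^ (k + 1))

/-- The quadrature formula `(bᵢ, cᵢ)` on `[0, 1]` is of order (at least) `p`: it is exact for
polynomials of degree up to `p - 1`. -/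
def QuadratureOrder {s : ℕ} (b c : Fin s → ℝ) (p : ℕ) : Prop :=
  ∀ g : Polynomial ℝ, g.degree < (p : WithBot ℕ) →
    ∑ i, b i * g.eval (c i) = ∫ x in (0 : ℝ)..1, g.eval x

/-- The coefficients of a continuous-stage Runge-Kutta-Nyström method
`Q_τ = q₀ + h C_τ q'₀ + h² ∫₀¹ Ā_{τ,σ} f(t₀ + C_σ h, Q_σ) dσ` for `τ ∈ [0, 1]`,
`q₁ = q₀ + h q'₀ + h² ∫₀¹ B̄_τ f(t₀ + C_τ h, Q_τ) dτ`,
`q'₁ = q'₀ + h ∫₀¹ B_τ f(t₀ + C_τ h, Q_τ) dτ`. -/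
structure CSRKN where
  Abar : ℝ → ℝ → ℝ
  Bbar : ℝ → ℝ
  B : ℝ → ℝ
  C : ℝ → ℝ

namespace CSRKN

/-- The simplifying assumption `CN(η)`. -/
def CN (M : CSRKN) (η : ℕ) : Prop :=
  ∀ κ : ℕ, 1 ≤ κ → κ + 1 ≤ η → ∀ τ ∈ Set.Icc (0 : ℝ) 1,
    ∫ σ in (0 : ℝ)..1, M.Abar τ σ * M.C σ ^ (κ - 1) = M.C τ ^ (κ + 1) / ((κ : ℝ) * (κ + 1))

/-- The simplifying assumption `DN(ζ)`. -/
def DN (M : CSRKN) (ζ : ℕ) : Prop :=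
  ∀ κ : ℕ, 1 ≤ κ → κ + 1 ≤ ζ → ∀ σ ∈ Set.Icc (0 : ℝ) 1,
    ∫ τ in (0 : ℝ)..1, M.B τ * M.C τ ^ (κ - 1) * M.Abar τ σ =
      M.B σ * M.C σ ^ (κ + 1) / ((κ : ℝ) * (κ + 1)) - M.B σ * M.C σ / κ + M.B σ / ((κ : ℝ) + 1)

/-- The RKN method obtained by applying the quadrature formula `(bᵢ, cᵢ)` to the integrals of
the continuous-stage method. -/
def discretize (M : CSRKN) {s : ℕ} (b c : Fin s → ℝ) : RKN s where
  Abar := Matrix.of fun i j => b j * M.Abar (c i) (c j)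
  bbar := fun i => b i * M.Bbar (c i)
  b := fun i => b i * M.B (c i)
  c := fun i => M.C (c i)

end CSRKN

/-! ### Taylor expansions with big-O remainder -/

section Taylor

variable {F : Type*} [NormedAddCommGroup F] [NormedSpace ℝ F]

/-! The quadrature is exact on the polynomial integrands in CN and DN when their degree is below
`p`, so the discrete method inherits classical simplifying assumptions (`RKN.Simplifying`) with `a =
α - 1` stage and `b = β - 1` adjoint conditions. No order trees are needed after that.

Inserting the exact solution into the stage equations leaves a defect `δ`, and the stage errors
satisfy `e = h² Ā D - δ`, where `D` is the error of `f` at the stages and `D = J e + O(|e|²)`. The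
stage conditions give `e = O(h^(a+2))`, so the quadratic term is `O(h^(2a+4))`: this is the bound
`2α + 2`.

The updates involve only the sums `∑ bᵢ cᵢ^l Dᵢ` with `l = 0, 1`, which are much smaller than the
individual `Dᵢ`. Expanding `J` in powers of `h cᵢ` reduces them to sums `∑ bᵢ cᵢ^l eᵢ`. In these,
the adjoint conditions turn `h² Ā D` back into `h²` times weighted sums of `D`, while the weighted
defects cancel up to the quadrature order (`sum_defectCoeff`). The recursion (`isBigO_sum_stage`)
gains powers of `h` until the pointwise bound on `e` suffices; having adjoint conditions for long
enough is the bound `α + β`. -/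

theorem isBigO_pow_succ_of_hasDerivAt {r r' : ℝ → F} {n : ℕ} (h0 : r 0 = 0)
    (hd : ∀ᶠ h in 𝓝 (0 : ℝ), HasDerivAt r (r' h) h)
    (hr' : r' =O[𝓝 0] fun h : ℝ => h ^ n) : r =O[𝓝 0] fun h : ℝ => h ^ (n + 1) := by
  obtain ⟨C, hC0, hC⟩ := hr'.exists_nonneg
  obtain ⟨ε, hε, H⟩ := Metric.eventually_nhds_iff_ball.1 (hd.and hC.bound)
  refine IsBigO.of_bound C ?_
  filter_upwards [Metric.ball_mem_nhds 0 hε] with h hh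
  have hsub : Metric.closedBall (0 : ℝ) |h| ⊆ Metric.ball 0 ε := by
    refine Metric.closedBall_subset_ball ?_
    simpa using hh
  have key := (convex_closedBall (0 : ℝ) |h|).norm_image_sub_le_of_norm_hasDerivWithin_le
    (f := r) (f' := r') (C := C * |h| ^ n) (x := 0) (y := h)
    (fun x hx => (H x (hsub hx)).1.hasDerivWithinAt)
    (fun x hx => ?_) (by simp) (by simp)
  · rw [h0, sub_zero, sub_zero] at key
    simpa [pow_succ, mul_assoc] using key
  · refine (H x (hsub hx)).2.trans ?_
    have hx' : |x| ≤ |h| := by simpa using hx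
    rw [norm_pow, Real.norm_eq_abs]
    gcongr

/-- The expansion `∑ hᵐ Tₘ + O(hᴺ)` of the derivative of `G` can be integrated. -/
theorem isBigO_expansion_of_hasDerivAt {G g : ℝ → F} {t₀ : ℝ} {T : ℕ → F} {N : ℕ}
    (hd : ∀ᶠ t in 𝓝 t₀, HasDerivAt G (g t) t)
    (hg : (fun h : ℝ => g (t₀ + h) - ∑ m ∈ Finset.range N, h ^ m • T m)
      =O[𝓝 0] fun h : ℝ => h ^ N) :
    (fun h : ℝ => G (t₀ + h) - G t₀
        - ∑ m ∈ Finset.range N, (h ^ (m + 1) / ((m : ℝ) + 1)) • T m)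
      =O[𝓝 0] fun h : ℝ => h ^ (N + 1) := by
  refine isBigO_pow_succ_of_hasDerivAt (by simp) ?_ hg
  have ht : Tendsto (fun h : ℝ => t₀ + h) (𝓝 0) (𝓝 t₀) := by
    have : ContinuousAt (fun h : ℝ => t₀ + h) 0 := by fun_prop
    simpa [ContinuousAt] using this
  filter_upwards [ht.eventually hd] with h hh
  refine ((hh.comp_const_add t₀ h).sub_const _).sub (HasDerivAt.fun_sum fun m _ => ?_)
  have h1 := ((hasDerivAt_pow (m + 1) h).div_const ((m : ℝ) + 1)).smul_const (T m)
  convert h1 using 2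
  have : (m : ℝ) + 1 ≠ 0 := by positivity
  push_cast
  field_simp

theorem ContDiffAt.exists_expansion {t₀ : ℝ} (N : ℕ) {g : ℝ → F}
    (hg : ContDiffAt ℝ (N : WithTop ℕ∞) g t₀) :
    ∃ T : ℕ → F, (fun h : ℝ => g (t₀ + h) - ∑ m ∈ Finset.range N, h ^ m • T m)
      =O[𝓝 0] fun h : ℝ => h ^ N := by
  induction N generalizing g with
  | zero =>
    refine ⟨0, ?_⟩
    have h1 : ContinuousAt (fun h : ℝ => g (t₀ + h)) 0 := by
      refine ContinuousAt.comp (g := g) ?_ (by fun_prop)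
      simpa using hg.continuousAt
    simpa using h1.tendsto.isBigO_one ℝ
  | succ N ih =>
    have hg' : ContDiffAt ℝ (N : WithTop ℕ∞) (deriv g) t₀ := by
      exact ContDiffAt.derivWithin hg (by norm_cast)
    have hd : ∀ᶠ t in 𝓝 t₀, HasDerivAt g (deriv g t) t := by
      have h1 : ContDiffAt ℝ 1 g t₀ := hg.of_le (by exact_mod_cast Nat.le_add_left 1 N)
      filter_upwards [h1.eventually (by simp)] with t ht
      exact (ht.differentiableAt (by simp)).hasDerivAt
    obtain ⟨T, hT⟩ := ih hg'
    refine ⟨fun m => Nat.casesOn m (g t₀) fun m => (1 / ((m : ℝ) + 1)) • T m, ?_⟩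
    refine (isBigO_expansion_of_hasDerivAt hd hT).congr_left fun h => ?_
    rw [Finset.sum_range_succ', pow_zero, one_smul, sub_sub, add_comm (g t₀)]
    simp [smul_smul, div_eq_mul_inv]

end Taylor

/-! ### Smoothness of the exact solution -/

section Regularity

variable {E : Type*} [NormedAddCommGroup E] [NormedSpace ℝ E]

theorem contDiffAt_succ_of_hasDerivAt {g g' : ℝ → E} {t₀ : ℝ} {n : ℕ}
    (hd : ∀ᶠ t in 𝓝 t₀, HasDerivAt g (g' t) t) (hg' : ContDiffAt ℝ (n : WithTop ℕ∞) g' t₀) :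
    ContDiffAt ℝ ((n + 1 : ℕ) : WithTop ℕ∞) g t₀ := by
  push_cast
  rw [contDiffAt_succ_iff_hasFDerivAt]
  refine ⟨fun t => ContinuousLinearMap.toSpanSingleton ℝ (g' t), ⟨_, hd, fun t ht => ht⟩, ?_⟩
  exact (ContinuousLinearMap.toSpanSingletonCLE (𝕜 := ℝ) (E := E)).contDiff.contDiffAt.comp t₀ hg'

theorem IsLocalSolution.contDiffAt {f : ℝ → E → E} {t₀ : ℝ} {q₀ v₀ : E} {q v : ℝ → E} {N : ℕ}
    (hf : ContDiffAt ℝ (N : WithTop ℕ∞) (Function.uncurry f) (t₀, q₀))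
    (hq : IsLocalSolution f t₀ q₀ v₀ q v) : ContDiffAt ℝ (N : WithTop ℕ∞) q t₀ := by
  obtain ⟨hq0, hv0, hd⟩ := hq
  have hdq := hd.mono fun _ h => h.1
  have hdv := hd.mono fun _ h => h.2
  suffices H : ∀ n ≤ N, ContDiffAt ℝ (n : WithTop ℕ∞) q t₀ from H N le_rfl
  intro n hn
  induction n with
  | zero =>
    refine ContDiffAt.of_le (n := ((0 + 1 : ℕ) : WithTop ℕ∞)) ?_ (by simp)
    refine contDiffAt_succ_of_hasDerivAt hdq ?_
    simp only [Nat.cast_zero]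
    exact contDiffAt_zero.2 ⟨_, hdv, fun t ht => HasDerivAt.continuousAt ht |>.continuousWithinAt⟩
  | succ n ih =>
    have h1 : ContDiffAt ℝ (n : WithTop ℕ∞) (fun t => f t (q t)) t₀ := by
      have h2 : ContDiffAt ℝ (n : WithTop ℕ∞) (Function.uncurry f) (t₀, q t₀) := by
        rw [hq0]; exact hf.of_le (by exact_mod_cast (Nat.le_succ n).trans hn)
      exact h2.comp (f := fun t => (t, q t)) t₀ (contDiffAt_id.prodMk (ih (by omega)))
    have h2 := contDiffAt_succ_of_hasDerivAt hdq (contDiffAt_succ_of_hasDerivAt hdv h1)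
    exact h2.of_le (by exact_mod_cast Nat.le_succ _)

end Regularity

/-! ### Quadratic remainder of the linearization -/

section Estimates

variable {V W ι : Type*} [NormedAddCommGroup V] [NormedSpace ℝ V]
  [NormedAddCommGroup W] [NormedSpace ℝ W]

/-- The base point moves with `h`, so differentiability at `z` alone is not enough. The derivative
is Lipschitz near `z`, and the mean value inequality on the segment gives a constant independent of
`h`. -/
theorem ContDiffAt.isBigO_sub_sub_fderiv {G : V → W} {z : V} (hG : ContDiffAt ℝ 2 G z)
    {l : Filter ι} {x y : ι → V} (hx : Tendsto x l (𝓝 z)) (hy : Tendsto y l (𝓝 z)) :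
    (fun h => G (y h) - G (x h) - fderiv ℝ G (x h) (y h - x h))
      =O[l] fun h => ‖y h - x h‖ ^ 2 := by
  have h1 : ContDiffAt ℝ 1 (fderiv ℝ G) z := hG.fderiv_right (by norm_num)
  obtain ⟨K, u, hu, hK⟩ := h1.exists_lipschitzOnWith
  have hd : ∀ᶠ w in 𝓝 z, DifferentiableAt ℝ G w := by
    filter_upwards [hG.eventually (by simp)] with w hw
    exact hw.differentiableAt (by simp)
  obtain ⟨ε, hε, H⟩ := Metric.eventually_nhds_iff_ball.1 (hd.and hu)
  refine IsBigO.of_bound K ?_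
  filter_upwards [hx (Metric.ball_mem_nhds z hε), hy (Metric.ball_mem_nhds z hε)] with h hxh hyh
  have hsub : segment ℝ (x h) (y h) ⊆ Metric.ball z ε :=
    (convex_ball z ε).segment_subset hxh hyh
  have key := (convex_segment (x h) (y h)).norm_image_sub_le_of_norm_fderiv_le' (𝕜 := ℝ)
    (f := G) (φ := fderiv ℝ G (x h)) (C := K * ‖y h - x h‖)
    (fun w hw => (H w (hsub hw)).1) (fun w hw => ?_)
    (left_mem_segment ℝ _ _) (right_mem_segment ℝ _ _)
  · simpa [pow_two, mul_assoc] using key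
  · refine (hK.norm_sub_le (H w (hsub hw)).2 (H _ hxh).2).trans ?_
    gcongr
    exact norm_sub_le_of_mem_segment hw

end Estimates

/-! ### Solvability of the stage equations -/

section Existence

variable {s : ℕ} {E : Type*} [NormedAddCommGroup E] [NormedSpace ℝ E]

/-- Implicit function theorem at `h = 0`: there the residual is `Q - q₀`, whose derivative in `Q` is
the identity. -/
theorem RKN.exists_isStageBranch [CompleteSpace E] (M : RKN s) {f : ℝ → E → E} {t₀ : ℝ}
    {q₀ : E} (v₀ : E) (hf : ContDiffAt ℝ 1 (Function.uncurry f) (t₀, q₀)) :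
    ∃ Q, M.IsStageBranch f t₀ q₀ v₀ Q := by
  let F : ℝ × (Fin s → E) → Fin s → E := fun x i => x.2 i - (q₀ + (x.1 * M.c i) • v₀
    + x.1 ^ 2 • ∑ j, M.Abar i j • f (t₀ + M.c j * x.1) (x.2 j))
  let u : ℝ × (Fin s → E) := (0, fun _ => q₀)
  have hproj (j : Fin s) : ContDiff ℝ 1 fun x : ℝ × (Fin s → E) => x.2 j :=
    (contDiff_apply ℝ E j).comp contDiff_snd
  have hF : ContDiffAt ℝ 1 F u := by
    refine contDiffAt_pi.2 fun i => (hproj i).contDiffAt.sub ((contDiffAt_const.add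
      ((contDiffAt_fst.mul contDiffAt_const).smul contDiffAt_const)).add
      ((contDiffAt_fst.pow 2).smul (ContDiffAt.sum fun j _ => contDiffAt_const.smul ?_)))
    have h1 : ContDiffAt ℝ 1 (Function.uncurry f) (t₀ + M.c j * u.1, u.2 j) := by
      simpa [u] using hf
    exact h1.comp (f := fun x : ℝ × (Fin s → E) => (t₀ + M.c j * x.1, x.2 j)) u
      ((contDiffAt_const.add (contDiffAt_const.mul contDiffAt_fst)).prodMk (hproj j).contDiffAt)
  have hstrict : HasStrictFDerivAt F (fderiv ℝ F u) u := hF.hasStrictFDerivAt (by simp)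
  have hid : fderiv ℝ F u ∘L .inr ℝ ℝ (Fin s → E) = .id ℝ (Fin s → E) := by
    have h1 : HasFDerivAt (fun Q : Fin s → E => F (0, Q))
        (fderiv ℝ F u ∘L .inr ℝ ℝ (Fin s → E)) (fun _ => q₀) :=
      HasFDerivAt.comp (g := F) _ hstrict.hasFDerivAt (hasFDerivAt_prodMk_right 0 _)
    have h2 : (fun Q : Fin s → E => F (0, Q)) = fun Q => Q - fun _ => q₀ := by
      ext Q i; simp [F]
    rw [h2] at h1
    exact h1.unique ((hasFDerivAt_id _).sub_const _)
  have hinv : (fderiv ℝ F u ∘L .inr ℝ ℝ (Fin s → E)).IsInvertible := by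
    rw [hid]; exact ⟨.refl ℝ _, rfl⟩
  have hFu : F u = 0 := by ext i; simp [F, u]
  refine ⟨hstrict.implicitFunctionOfProdDomain hinv, ?_, ?_⟩
  · have h1 := hstrict.eventually_apply_implicitFunctionOfProdDomain hinv
    rw [hFu] at h1
    filter_upwards [h1] with h hh i
    exact sub_eq_zero.1 (congrFun hh i)
  · have h1 := hstrict.tendsto_implicitFunctionOfProdDomain hinv
    exact fun i => (tendsto_pi_nhds.1 h1 i)

end Existence

/-! ### Calculus of bounds by powers of `h` -/

section PowerBounds

variable {F : Type*} [NormedAddCommGroup F]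

theorem isBigO_pow_of_le {m n : ℕ} (hmn : m ≤ n) :
    (fun h : ℝ => h ^ n) =O[𝓝 0] fun h : ℝ => h ^ m := by
  have h1 : (fun h : ℝ => h ^ (n - m)) =O[𝓝 0] fun _ : ℝ => (1 : ℝ) :=
    ((continuous_pow (n - m)).tendsto (0 : ℝ)).isBigO_one ℝ
  refine ((h1.mul (isBigO_refl (fun h : ℝ => h ^ m) (𝓝 0)))).congr (fun h => ?_) (fun h => ?_)
  · rw [← pow_add, Nat.sub_add_cancel hmn]
  · rw [one_mul]

theorem Asymptotics.IsBigO.pow_mono {r : ℝ → F} {m n : ℕ}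
    (hr : r =O[𝓝 0] fun h : ℝ => h ^ n) (hmn : m ≤ n) : r =O[𝓝 0] fun h : ℝ => h ^ m :=
  hr.trans (isBigO_pow_of_le hmn)

theorem Asymptotics.IsBigO.comp_const_mul {r : ℝ → F} {n : ℕ}
    (hr : r =O[𝓝 0] fun h : ℝ => h ^ n) (c : ℝ) :
    (fun h => r (c * h)) =O[𝓝 0] fun h : ℝ => h ^ n := by
  have hc : Tendsto (fun h : ℝ => c * h) (𝓝 0) (𝓝 0) := by
    have : ContinuousAt (fun h : ℝ => c * h) 0 := by fun_prop
    simpa [ContinuousAt] using this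
  refine (hr.comp_tendsto hc).trans ?_
  simp only [Function.comp_def, mul_pow]
  exact (isBigO_refl _ _).const_mul_left _

variable [NormedSpace ℝ F]

theorem Asymptotics.IsBigO.pow_smul {r : ℝ → F} {n : ℕ}
    (hr : r =O[𝓝 0] fun h : ℝ => h ^ n) (m : ℕ) :
    (fun h => h ^ m • r h) =O[𝓝 0] fun h : ℝ => h ^ (m + n) :=
  ((isBigO_refl (fun h : ℝ => h ^ m) (𝓝 0)).smul hr).congr_right fun h => by
    rw [smul_eq_mul, ← pow_add]

theorem isBigO_pow_smul_const {m n : ℕ} (hmn : m ≤ n) (x : F) :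
    (fun h : ℝ => h ^ n • x) =O[𝓝 0] fun h : ℝ => h ^ m := by
  have h1 : (fun _ : ℝ => x) =O[𝓝 0] fun h : ℝ => h ^ 0 := by
    simpa using isBigO_const_const x (one_ne_zero (α := ℝ)) (𝓝 (0 : ℝ))
  exact (h1.pow_smul n).pow_mono hmn

theorem Asymptotics.IsBigO.fun_const_smul {r : ℝ → F} {g : ℝ → ℝ} (hr : r =O[𝓝 0] g) (c : ℝ) :
    (fun h => c • r h) =O[𝓝 0] g :=
  hr.const_smul_left c

end PowerBounds

/-! ### Simplifying assumptions and propagation of the stage errors -/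

namespace RKN

variable {s : ℕ}

/-- The classical simplifying assumptions of a Runge-Kutta-Nyström method. -/
structure Simplifying (M : RKN s) (p a b : ℕ) : Prop where
  moment : ∀ n < p, ∑ i, M.b i * M.c i ^ n = 1 / ((n : ℝ) + 1)
  stage : ∀ m < a, ∀ i,
    ∑ j, M.Abar i j * M.c j ^ m = M.c i ^ (m + 2) / (((m : ℝ) + 1) * ((m : ℝ) + 2))
  adjoint : ∀ l < b, ∀ j, ∑ i, M.b i * M.c i ^ l * M.Abar i j =
    M.b j * (M.c j ^ (l + 2) / (((l : ℝ) + 1) * ((l : ℝ) + 2)) - M.c j / ((l : ℝ) + 1)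
      + 1 / ((l : ℝ) + 2))
  bbar_eq : ∀ i, M.bbar i = M.b i * (1 - M.c i)

/-- The coefficient of `h ^ (m + 2)` in the defect of the `i`-th stage. -/
noncomputable def defectCoeff (M : RKN s) (m : ℕ) (i : Fin s) : ℝ :=
  M.c i ^ (m + 2) / (((m : ℝ) + 1) * ((m : ℝ) + 2)) - ∑ j, M.Abar i j * M.c j ^ m

/-- After interchanging the sums, the adjoint condition leaves only moments of orders `m`, `m + 1`
and `l + m + 2`, and the resulting rational expressions in `l` and `m` cancel. -/
theorem Simplifying.sum_defectCoeff {M : RKN s} {p a b : ℕ} (hM : M.Simplifying p a b)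
    {l m : ℕ} (hl : l < b) (hlm : l + m + 2 < p) :
    ∑ i, M.b i * M.c i ^ l * M.defectCoeff m i = 0 := by
  have h1 : ∑ i, M.b i * M.c i ^ l * (M.c i ^ (m + 2) / (((m : ℝ) + 1) * ((m : ℝ) + 2)))
      = 1 / ((l : ℝ) + m + 3) / (((m : ℝ) + 1) * ((m : ℝ) + 2)) := by
    have := hM.moment (l + m + 2) hlm
    push_cast at this
    rw [show (l : ℝ) + m + 3 = l + m + 2 + 1 by ring, ← this, Finset.sum_div]
    exact Finset.sum_congr rfl fun i _ => by ring
  have h2 : ∑ i, M.b i * M.c i ^ l * ∑ j, M.Abar i j * M.c j ^ m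
      = 1 / ((l : ℝ) + m + 3) / (((l : ℝ) + 1) * ((l : ℝ) + 2))
        - 1 / ((m : ℝ) + 2) / ((l : ℝ) + 1) + 1 / ((m : ℝ) + 1) / ((l : ℝ) + 2) := by
    have e1 := hM.moment (l + m + 2) hlm
    have e2 := hM.moment (m + 1) (by omega)
    have e3 := hM.moment m (by omega)
    push_cast at e1 e2
    rw [show (l : ℝ) + m + 3 = l + m + 2 + 1 by ring, show (m : ℝ) + 2 = m + 1 + 1 by ring,
      ← e1, ← e2, ← e3, Finset.sum_div, Finset.sum_div, Finset.sum_div,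
      ← Finset.sum_sub_distrib, ← Finset.sum_add_distrib]
    simp_rw [Finset.mul_sum]
    rw [Finset.sum_comm]
    refine Finset.sum_congr rfl fun j _ => ?_
    have := hM.adjoint l hl j
    calc ∑ i, M.b i * M.c i ^ l * (M.Abar i j * M.c j ^ m)
        = (∑ i, M.b i * M.c i ^ l * M.Abar i j) * M.c j ^ m := by
          rw [Finset.sum_mul]; exact Finset.sum_congr rfl fun i _ => by ring
      _ = _ := by rw [this]; ring
  simp_rw [defectCoeff, mul_sub, Finset.sum_sub_distrib]
  rw [h1, h2]
  field_simp
  ring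

variable {E : Type*} [NormedAddCommGroup E] [NormedSpace ℝ E]

/-- The stage errors `e`, the errors `D` of the values of `f` at the stages and the defects `δ` of
the exact solution, with the asymptotic expansions of `δ` and of the Jacobian `J` along the exact
solution. -/
structure ErrorExpansion (M : RKN s) (N : ℕ) (e D δ : ℝ → Fin s → E)
    (J : ℝ → Fin s → E →L[ℝ] E) (T : ℕ → E) (L : ℕ → E →L[ℝ] E) : Prop where
  eq : ∀ᶠ h in 𝓝 0, ∀ i, e h i = h ^ 2 • ∑ j, M.Abar i j • D h j - δ h i
  bounded : ∀ i, (fun h => e h i) =O[𝓝 0] fun h : ℝ => h ^ 0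
  defect : ∀ i, (fun h => δ h i - ∑ m ∈ Finset.range N, h ^ (m + 2) • M.defectCoeff m i • T m)
    =O[𝓝 0] fun h : ℝ => h ^ (N + 2)
  lipschitz : ∀ j, (fun h => D h j) =O[𝓝 0] fun h => e h j
  linear : ∀ j, (fun h => D h j - J h j (e h j)) =O[𝓝 0] fun h => ‖e h j‖ ^ 2
  jacobian : ∀ j, (fun h => J h j - ∑ n ∈ Finset.range N, h ^ n • M.c j ^ n • L n)
    =O[𝓝 0] fun h : ℝ => h ^ N

namespace ErrorExpansion

variable {M : RKN s} {N p a b K : ℕ} {e D δ : ℝ → Fin s → E} {J : ℝ → Fin s → E →L[ℝ] E}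
  {T : ℕ → E} {L : ℕ → E →L[ℝ] E}

theorem isBigO_defect (H : M.ErrorExpansion N e D δ J T L) (hM : M.Simplifying p a b)
    (haN : a ≤ N) (i : Fin s) : (fun h => δ h i) =O[𝓝 0] fun h : ℝ => h ^ (a + 2) := by
  have h1 := (H.defect i).pow_mono (m := a + 2) (by omega)
  have h2 : (fun h : ℝ => ∑ m ∈ Finset.range N, h ^ (m + 2) • M.defectCoeff m i • T m)
      =O[𝓝 0] fun h : ℝ => h ^ (a + 2) := by
    refine IsBigO.fun_sum fun m _ => ?_
    rcases lt_or_ge m a with hm | hm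
    · have : M.defectCoeff m i = 0 := by rw [defectCoeff, hM.stage m hm i, sub_self]
      simp only [this, zero_smul, smul_zero]
      exact isBigO_zero _ _
    · exact isBigO_pow_smul_const (by omega) _
  simpa using h1.add h2

/-- Bootstrap from boundedness: the factor `h²` improves any known bound on `e` until the defect
dominates. -/
theorem isBigO_stage (H : M.ErrorExpansion N e D δ J T L) (hM : M.Simplifying p a b)
    (haN : a ≤ N) (i : Fin s) : (fun h => e h i) =O[𝓝 0] fun h : ℝ => h ^ (a + 2) := by
  suffices h1 : ∀ n ≤ a + 2, ∀ i, (fun h => e h i) =O[𝓝 0] fun h : ℝ => h ^ n from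
    h1 _ le_rfl i
  intro n
  induction n with
  | zero => exact fun _ => H.bounded
  | succ n ih =>
    intro hn i
    have h2 : (fun h : ℝ => h ^ 2 • ∑ j, M.Abar i j • D h j) =O[𝓝 0] fun h : ℝ => h ^ (n + 1) :=
      IsBigO.pow_mono (IsBigO.pow_smul (n := n) (IsBigO.fun_sum fun j _ =>
        ((H.lipschitz j).trans (ih (by omega) j)).fun_const_smul _) 2) (by omega)
    have h3 := h2.sub ((H.isBigO_defect hM haN i).pow_mono hn)
    exact h3.congr' (H.eq.mono fun h hh => (hh i).symm) EventuallyEq.rfl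

theorem isBigO_sum_defect (H : M.ErrorExpansion N e D δ J T L) (hM : M.Simplifying p a b)
    {l k : ℕ} (hl : l < b) (hkl : k + l ≤ p) (hkN : k ≤ N) :
    (fun h => ∑ i, (M.b i * M.c i ^ l) • δ h i) =O[𝓝 0] fun h : ℝ => h ^ k := by
  have h1 : (fun h => ∑ i, (M.b i * M.c i ^ l) •
      (δ h i - ∑ m ∈ Finset.range N, h ^ (m + 2) • M.defectCoeff m i • T m))
      =O[𝓝 0] fun h : ℝ => h ^ k :=
    IsBigO.fun_sum fun i _ => ((H.defect i).pow_mono (by omega)).fun_const_smul _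
  have h2 : (fun h : ℝ => ∑ m ∈ Finset.range N,
      h ^ (m + 2) • (∑ i, M.b i * M.c i ^ l * M.defectCoeff m i) • T m)
      =O[𝓝 0] fun h : ℝ => h ^ k := by
    refine IsBigO.fun_sum fun m _ => ?_
    rcases lt_or_ge (l + m + 2) p with hm | hm
    · simp only [hM.sum_defectCoeff hl hm, zero_smul, smul_zero]
      exact isBigO_zero _ _
    -- Here `m + 2 ≥ p - l ≥ k`, so the surviving term is already small enough.
    · exact isBigO_pow_smul_const (by omega) _
  refine (h1.add h2).congr_left fun h => ?_
  simp_rw [smul_sub, Finset.sum_sub_distrib, Finset.smul_sum, Finset.sum_smul, Finset.smul_sum]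
  rw [Finset.sum_comm (s := Finset.range N), sub_add_eq_add_sub, add_sub_assoc, add_eq_left,
    sub_eq_zero]
  refine Finset.sum_congr rfl fun i _ => Finset.sum_congr rfl fun m _ => ?_
  simp only [smul_smul]
  congr 1; ring

/-- Split `D = (D - J e) + (J - ∑ hⁿ cⁿ Lₙ) e + ∑ hⁿ cⁿ Lₙ e`. The `n`-th term of the last sum
carries `hⁿ`, so order `k - n` suffices for its weighted sum of `e`. -/
theorem isBigO_sum_diff (H : M.ErrorExpansion N e D δ J T L) (hM : M.Simplifying p a b)
    (haN : a ≤ N) {i k : ℕ} (hka : k ≤ 2 * a + 4) (hkN : k ≤ N)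
    (hS : ∀ n, (fun h => ∑ j, (M.b j * M.c j ^ (i + n)) • e h j)
      =O[𝓝 0] fun h : ℝ => h ^ (k - n)) :
    (fun h => ∑ j, (M.b j * M.c j ^ i) • D h j) =O[𝓝 0] fun h : ℝ => h ^ k := by
  have h1 : (fun h => ∑ j, (M.b j * M.c j ^ i) • (D h j - J h j (e h j)))
      =O[𝓝 0] fun h : ℝ => h ^ k := by
    refine IsBigO.fun_sum fun j _ => IsBigO.fun_const_smul ?_ _
    refine (H.linear j).trans (((H.isBigO_stage hM haN j).norm_left.pow 2).trans ?_)
    simp only [← pow_mul]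
    exact isBigO_pow_of_le (by omega)
  have h2 : (fun h => ∑ j, (M.b j * M.c j ^ i) •
      ((J h j - ∑ n ∈ Finset.range N, h ^ n • M.c j ^ n • L n) (e h j)))
      =O[𝓝 0] fun h : ℝ => h ^ k := by
    refine IsBigO.fun_sum fun j _ => IsBigO.fun_const_smul ?_ _
    have h3 := ((H.jacobian j).norm_left.mul (H.bounded j).norm_left)
    simp only [← pow_add, add_zero] at h3
    refine (IsBigO.trans (IsBigO.of_norm_le fun h => ?_) h3).trans (isBigO_pow_of_le hkN)
    exact ContinuousLinearMap.le_opNorm _ _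
  have h3 : (fun h : ℝ => ∑ n ∈ Finset.range N,
      h ^ n • L n (∑ j, (M.b j * M.c j ^ (i + n)) • e h j)) =O[𝓝 0] fun h : ℝ => h ^ k :=
    IsBigO.fun_sum fun n _ =>
      ((((L n).isBigO_comp _ _).trans (hS n)).pow_smul n).pow_mono (by omega)
  refine ((h1.add h2).add h3).congr_left fun h => ?_
  simp_rw [map_sum, Finset.smul_sum]
  rw [Finset.sum_comm (s := Finset.range N), ← Finset.sum_add_distrib, ← Finset.sum_add_distrib]
  refine Finset.sum_congr rfl fun j _ => ?_
  rw [sub_apply, sum_apply, ← smul_add, sub_add_sub_cancel,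
    smul_sub, Finset.smul_sum, sub_add_eq_add_sub, add_sub_assoc, add_eq_left, sub_eq_zero]
  refine Finset.sum_congr rfl fun n _ => ?_
  simp only [map_smul, smul_apply, smul_smul]
  congr 1; ring

/-- The recursion trades powers of `h` for powers of `c` and keeps `k + l ≤ K`. The alternative `k =
0` absorbs the truncated subtraction `k - 2 - n`. -/
theorem isBigO_sum_stage (H : M.ErrorExpansion N e D δ J T L) (hM : M.Simplifying p a b)
    (haN : a ≤ N) (hKN : K ≤ N) (hKp : K ≤ p) (hKa : K ≤ 2 * a + 4) (hKab : K ≤ a + b + 2)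
    {l k : ℕ} (hkl : k + l ≤ K ∨ k = 0) :
    (fun h => ∑ i, (M.b i * M.c i ^ l) • e h i) =O[𝓝 0] fun h : ℝ => h ^ k := by
  induction k using Nat.strong_induction_on generalizing l with
  | _ k ih =>
  by_cases hka : k ≤ a + 2
  · exact IsBigO.fun_sum fun i _ => ((H.isBigO_stage hM haN i).pow_mono hka).fun_const_smul _
  -- From `k > a + 2` and `k + l ≤ K ≤ a + b + 2`: an adjoint condition is available exactly when
  -- the pointwise bound fails.
  have hl : l < b := by omega
  have hD : ∀ i ≤ l + 2, (fun h => ∑ j, (M.b j * M.c j ^ i) • D h j)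
      =O[𝓝 0] fun h : ℝ => h ^ (k - 2) := fun i hi =>
    H.isBigO_sum_diff hM haN (by omega) (by omega) fun n => ih (k - 2 - n) (by omega) (by omega)
  have h1 := (((((hD (l + 2) le_rfl).fun_const_smul (1 / (((l : ℝ) + 1) * ((l : ℝ) + 2)))).sub
    ((hD 1 (by omega)).fun_const_smul (1 / ((l : ℝ) + 1)))).add
    ((hD 0 (by omega)).fun_const_smul (1 / ((l : ℝ) + 2)))).pow_smul 2).pow_mono
      (m := k) (by omega)
  have h2 := h1.sub (H.isBigO_sum_defect hM hl (k := k) (by omega) (by omega))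
  refine h2.congr' (H.eq.mono fun h hh => ?_) EventuallyEq.rfl
  simp only [hh, smul_sub, Finset.sum_sub_distrib]
  congr 1
  simp_rw [smul_comm _ (h ^ 2), ← Finset.smul_sum]
  congr 1
  simp_rw [Finset.smul_sum]
  rw [Finset.sum_comm (f := fun i j => (M.b i * M.c i ^ l) • M.Abar i j • D h j),
    ← Finset.sum_sub_distrib, ← Finset.sum_add_distrib]
  refine Finset.sum_congr rfl fun j _ => ?_
  simp only [smul_smul, ← Finset.sum_smul, ← sub_smul, ← add_smul]
  rw [hM.adjoint l hl j]
  congr 1; ring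

theorem isBigO_sum_diff_of_le (H : M.ErrorExpansion N e D δ J T L) (hM : M.Simplifying p a b)
    (haN : a ≤ N) (hKN : K ≤ N) (hKp : K ≤ p) (hKa : K ≤ 2 * a + 4) (hKab : K ≤ a + b + 2)
    {l k : ℕ} (hkl : k + l ≤ K ∨ k = 0) :
    (fun h => ∑ i, (M.b i * M.c i ^ l) • D h i) =O[𝓝 0] fun h : ℝ => h ^ k :=
  H.isBigO_sum_diff hM haN (by omega) (by omega) fun n =>
    H.isBigO_sum_stage hM haN hKN hKp hKa hKab (by omega)

end ErrorExpansion

end RKN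

/-! ### Expansions of quadrature errors and of the exact solution -/

section Expansions

variable {F : Type*} [NormedAddCommGroup F] [NormedSpace ℝ F]

theorem isBigO_expansion_comp_const_mul {g : ℝ → F} {t₀ : ℝ} {T : ℕ → F} {N : ℕ}
    (hg : (fun h : ℝ => g (t₀ + h) - ∑ m ∈ Finset.range N, h ^ m • T m)
      =O[𝓝 0] fun h : ℝ => h ^ N) (c : ℝ) :
    (fun h : ℝ => g (t₀ + c * h) - ∑ m ∈ Finset.range N, h ^ m • c ^ m • T m)
      =O[𝓝 0] fun h : ℝ => h ^ N := by
  refine (hg.comp_const_mul c).congr_left fun h => ?_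
  simp only [smul_smul, mul_pow, mul_comm]

/-- Subtracting the quadrature sum of `g` from a function whose expansion involves the Taylor
coefficients `Tₘ` of `g`. -/
theorem isBigO_sub_quadrature {s : ℕ} {Φ g : ℝ → F} {t₀ : ℝ} {T : ℕ → F} {N k : ℕ} {A : ℕ → ℝ}
    (hΦ : (fun h : ℝ => Φ h - ∑ m ∈ Finset.range N, h ^ (m + k) • A m • T m)
      =O[𝓝 0] fun h : ℝ => h ^ (N + k))
    (hg : (fun h : ℝ => g (t₀ + h) - ∑ m ∈ Finset.range N, h ^ m • T m)
      =O[𝓝 0] fun h : ℝ => h ^ N) (w c : Fin s → ℝ) :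
    (fun h : ℝ => Φ h - h ^ k • ∑ j, w j • g (t₀ + c j * h)
        - ∑ m ∈ Finset.range N, h ^ (m + k) • (A m - ∑ j, w j * c j ^ m) • T m)
      =O[𝓝 0] fun h : ℝ => h ^ (N + k) := by
  have h1 : (fun h : ℝ => h ^ k • ∑ j, w j •
      (g (t₀ + c j * h) - ∑ m ∈ Finset.range N, h ^ m • c j ^ m • T m))
      =O[𝓝 0] fun h : ℝ => h ^ (N + k) := by
    rw [add_comm N k]
    exact (IsBigO.fun_sum fun j _ =>
      (isBigO_expansion_comp_const_mul hg (c j)).fun_const_smul (w j)).pow_smul k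
  refine (hΦ.sub h1).congr_left fun h => ?_
  simp_rw [smul_sub, Finset.sum_sub_distrib, sub_smul, smul_sub, Finset.sum_sub_distrib]
  have h2 : h ^ k • ∑ j, w j • ∑ m ∈ Finset.range N, h ^ m • c j ^ m • T m
      = ∑ m ∈ Finset.range N, h ^ (m + k) • (∑ j, w j * c j ^ m) • T m := by
    simp_rw [Finset.sum_smul, Finset.smul_sum]
    rw [Finset.sum_comm]
    refine Finset.sum_congr rfl fun m _ => Finset.sum_congr rfl fun j _ => ?_
    simp only [smul_smul]
    congr 1; ring
  rw [h2]
  abel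

theorem isBigO_of_expansion {Φ : ℝ → F} {T : ℕ → F} {N K k : ℕ} {A : ℕ → ℝ}
    (hΦ : (fun h : ℝ => Φ h - ∑ m ∈ Finset.range N, h ^ (m + k) • A m • T m)
      =O[𝓝 0] fun h : ℝ => h ^ (N + k)) (hK : K ≤ N + k) (hA : ∀ m, m + k < K → A m = 0) :
    Φ =O[𝓝 0] fun h : ℝ => h ^ K := by
  have h1 : (fun h : ℝ => ∑ m ∈ Finset.range N, h ^ (m + k) • A m • T m)
      =O[𝓝 0] fun h : ℝ => h ^ K := by
    refine IsBigO.fun_sum fun m _ => ?_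
    rcases lt_or_ge (m + k) K with hm | hm
    · simp only [hA m hm, zero_smul, smul_zero]
      exact isBigO_zero _ _
    · exact isBigO_pow_smul_const hm _
  simpa using (hΦ.pow_mono hK).add h1

/-- Two integrations of the expansion of `q''`. The factor `x` is a node `cᵢ` for the stages and `1`
for the endpoint. -/
theorem IsLocalSolution.isBigO_expansion {f : ℝ → F → F} {t₀ : ℝ} {q₀ v₀ : F} {q v : ℝ → F}
    (hq : IsLocalSolution f t₀ q₀ v₀ q v) {T : ℕ → F} {N : ℕ}
    (hT : (fun h : ℝ => f (t₀ + h) (q (t₀ + h)) - ∑ m ∈ Finset.range N, h ^ m • T m)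
      =O[𝓝 0] fun h : ℝ => h ^ N) :
    ((fun h : ℝ => v (t₀ + h) - v₀
        - ∑ m ∈ Finset.range N, h ^ (m + 1) • (1 / ((m : ℝ) + 1)) • T m)
      =O[𝓝 0] fun h : ℝ => h ^ (N + 1)) ∧
    ∀ x : ℝ, (fun h : ℝ => q (t₀ + x * h) - q₀ - (h * x) • v₀ - ∑ m ∈ Finset.range N,
        h ^ (m + 2) • (x ^ (m + 2) / (((m : ℝ) + 1) * ((m : ℝ) + 2))) • T m)
      =O[𝓝 0] fun h : ℝ => h ^ (N + 2) := by
  obtain ⟨hq0, hv0, hd⟩ := hq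
  have h1 := isBigO_expansion_of_hasDerivAt (g := fun t => f t (q t)) (hd.mono fun _ h => h.2) hT
  rw [hv0] at h1
  refine ⟨h1.congr_left fun h => by simp only [smul_smul, mul_one_div], fun x => ?_⟩
  let T' : ℕ → F := fun m => Nat.casesOn m v₀ fun m => (1 / ((m : ℝ) + 1)) • T m
  have h2 : (fun h : ℝ => v (t₀ + h) - ∑ m ∈ Finset.range (N + 1), h ^ m • T' m)
      =O[𝓝 0] fun h : ℝ => h ^ (N + 1) := by
    refine h1.congr_left fun h => ?_
    rw [Finset.sum_range_succ', pow_zero, one_smul, sub_sub, add_comm v₀]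
    simp [T', smul_smul, div_eq_mul_inv]
  have h3 := isBigO_expansion_of_hasDerivAt (hd.mono fun _ h => h.1) h2
  rw [hq0] at h3
  refine (h3.comp_const_mul x).congr_left fun h => ?_
  rw [Finset.sum_range_succ', sub_sub _ ((h * x) • v₀), add_comm ((h * x) • v₀)]
  congr 2
  · refine Finset.sum_congr rfl fun m _ => ?_
    simp only [T', smul_smul]
    congr 1
    push_cast
    have h4 : (m : ℝ) + 1 ≠ 0 := by positivity
    have h5 : (m : ℝ) + 2 ≠ 0 := by positivity
    have h6 : (m : ℝ) + 1 + 1 ≠ 0 := by positivity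
    rw [show (m : ℝ) + 1 + 1 = m + 2 by ring] at *
    field_simp
    ring
  · simp [T', mul_comm]

end Expansions

/-! ### Order from the simplifying assumptions -/

namespace RKN

variable {s : ℕ} {E : Type*} [NormedAddCommGroup E] [NormedSpace ℝ E]

/-- The expansion of the stage errors along an exact solution of the differential equation. -/
theorem IsStageBranch.errorExpansion {M : RKN s} {f : ℝ → E → E} {t₀ : ℝ} {q₀ v₀ : E}
    {q v : ℝ → E} {Q : ℝ → Fin s → E} {N : ℕ}
    (hf : ContDiffAt ℝ ((N + 2 : ℕ) : WithTop ℕ∞) (Function.uncurry f) (t₀, q₀))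
    (hq : IsLocalSolution f t₀ q₀ v₀ q v) (hQ : M.IsStageBranch f t₀ q₀ v₀ Q) {T : ℕ → E}
    (hT : (fun h : ℝ => f (t₀ + h) (q (t₀ + h)) - ∑ m ∈ Finset.range N, h ^ m • T m)
      =O[𝓝 0] fun h : ℝ => h ^ N) :
    ∃ δ J L, M.ErrorExpansion N (fun h i => Q h i - q (t₀ + M.c i * h))
      (fun h i => f (t₀ + M.c i * h) (Q h i) - f (t₀ + M.c i * h) (q (t₀ + M.c i * h)))
      δ J T L := by
  have hqc := hq.contDiffAt hf
  have hz : ContDiffAt ℝ ((N + 2 : ℕ) : WithTop ℕ∞) (fun t => (t, q t)) t₀ :=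
    contDiffAt_id.prodMk hqc
  -- Numerical and exact stages are compared at the same time, so only the partial derivative in `q`
  -- enters.
  let Jt : ℝ → E →L[ℝ] E := fun t =>
    (fderiv ℝ (Function.uncurry f) (t, q t)) ∘L (.inr ℝ ℝ E)
  have hJt : ContDiffAt ℝ (N : WithTop ℕ∞) Jt t₀ := by
    have h1 : ContDiffAt ℝ (N : WithTop ℕ∞) (fderiv ℝ (Function.uncurry f)) (t₀, q t₀) := by
      rw [hq.1]
      exact hf.fderiv_right (by exact_mod_cast Nat.le_succ (N + 1))
    have h2 := h1.comp (f := fun t => (t, q t)) t₀ (hz.of_le (by exact_mod_cast Nat.le_add_right N 2))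
    exact h2.clm_comp contDiffAt_const
  obtain ⟨L, hL⟩ := hJt.exists_expansion
  have htime (i : Fin s) : Tendsto (fun h : ℝ => t₀ + M.c i * h) (𝓝 0) (𝓝 t₀) := by
    have : ContinuousAt (fun h : ℝ => t₀ + M.c i * h) 0 := by fun_prop
    simpa [ContinuousAt] using this
  have hpos (i : Fin s) : Tendsto (fun h : ℝ => q (t₀ + M.c i * h)) (𝓝 0) (𝓝 q₀) := by
    have := hqc.continuousAt.tendsto.comp (htime i)
    rwa [hq.1] at this
  have hf2 : ContDiffAt ℝ 2 (Function.uncurry f) (t₀, q₀) :=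
    hf.of_le (by exact_mod_cast Nat.le_add_left 2 N)
  refine ⟨fun h i => q (t₀ + M.c i * h) - q₀ - (h * M.c i) • v₀
      - h ^ 2 • ∑ j, M.Abar i j • f (t₀ + M.c j * h) (q (t₀ + M.c j * h)),
    fun h i => Jt (t₀ + M.c i * h), L, ?_, ?_, ?_, ?_, ?_, ?_⟩
  · filter_upwards [hQ.1] with h hh i
    simp only [smul_sub, Finset.sum_sub_distrib]
    nth_rewrite 1 [hh i]
    abel
  · intro i
    have := ((hQ.2 i).sub (hpos i)).isBigO_one ℝ
    simpa using this
  · intro i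
    exact isBigO_sub_quadrature (g := fun t => f t (q t)) ((hq.isBigO_expansion hT).2 (M.c i)) hT
      (M.Abar i) M.c
  · intro j
    obtain ⟨K, u, hu, hK⟩ :=
      (hf2.of_le (by norm_num : (1 : WithTop ℕ∞) ≤ 2)).exists_lipschitzOnWith
    refine IsBigO.of_bound K ?_
    filter_upwards [((htime j).prodMk_nhds (hpos j)) hu, ((htime j).prodMk_nhds (hQ.2 j)) hu]
      with h h1 h2
    simpa [Prod.norm_def] using hK.norm_sub_le h2 h1
  · intro j
    have := hf2.isBigO_sub_sub_fderiv ((htime j).prodMk_nhds (hpos j))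
      ((htime j).prodMk_nhds (hQ.2 j))
    simpa [Jt, Prod.norm_def] using this
  · intro j
    exact isBigO_expansion_comp_const_mul hL (M.c j)

theorem Simplifying.hasOrder {M : RKN s} {p a b K : ℕ} (hM : M.Simplifying p a b)
    (hKp : K ≤ p) (hKa : K ≤ 2 * a + 4) (hKab : K ≤ a + b + 2) : M.HasOrder K := by
  -- Expansions of length `K + a` cover both `a ≤ N` and `K ≤ N`; the two extra derivatives serve
  -- the Jacobian and the quadratic remainder.
  refine ⟨K + a + 2, fun d f t₀ q₀ v₀ q v hf hq => ⟨?_, fun Q hQ => ?_⟩⟩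
  · exact M.exists_isStageBranch v₀ (hf.of_le (by exact_mod_cast Nat.le_add_left 1 (K + a + 1)))
  have hg : ContDiffAt ℝ ((K + a : ℕ) : WithTop ℕ∞) (fun t => f t (q t)) t₀ := by
    have h1 : ContDiffAt ℝ ((K + a + 2 : ℕ) : WithTop ℕ∞) (Function.uncurry f) (t₀, q t₀) := by
      rw [hq.1]; exact hf
    exact (h1.comp (f := fun t => (t, q t)) t₀ (contDiffAt_id.prodMk (hq.contDiffAt hf))).of_le
      (by exact_mod_cast Nat.le_add_right _ 2)
  obtain ⟨T, hT⟩ := hg.exists_expansion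
  obtain ⟨δ, J, L, H⟩ := hQ.errorExpansion hf hq hT
  obtain ⟨hv, hpos⟩ := hq.isBigO_expansion hT
  have hD {l k : ℕ} (hkl : k + l ≤ K ∨ k = 0) :=
    H.isBigO_sum_diff_of_le hM (by omega) (by omega) hKp hKa hKab hkl
  constructor
  · have h1 := isBigO_of_expansion (K := K + 1) (isBigO_sub_quadrature (g := fun t => f t (q t))
      (hpos 1) hT M.bbar M.c) (by omega) fun m hm => by
        have e1 := hM.moment m (by omega)
        have e2 := hM.moment (m + 1) (by omega)
        simp only [hM.bbar_eq, mul_sub, sub_mul, mul_one, Finset.sum_sub_distrib, e1]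
        simp only [mul_assoc, ← pow_succ', e2]
        push_cast
        have h4 : (m : ℝ) + 1 ≠ 0 := by positivity
        have h5 : (m : ℝ) + 2 ≠ 0 := by positivity
        rw [show (m : ℝ) + 1 + 1 = m + 2 by ring]
        field_simp
        ring
    -- The weight `b (1 - c)` involves `l = 1`, which costs one order; the prefactor `h²` restores
    -- it.
    have h2 := (((hD (l := 0) (k := K - 1) (by omega)).sub
      (hD (l := 1) (k := K - 1) (by omega))).pow_smul 2).pow_mono (m := K + 1) (by omega)
    refine (h1.sub h2).congr_left fun h => ?_
    simp only [nextPos, hM.bbar_eq, pow_zero, pow_one, mul_sub, sub_smul, smul_sub,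
      Finset.sum_sub_distrib, one_mul, mul_one]
    abel
  · have h1 := isBigO_of_expansion (K := K + 1) (isBigO_sub_quadrature (g := fun t => f t (q t))
      hv hT M.b M.c) (by omega) fun m hm => by rw [hM.moment m (by omega), sub_self]
    have h2 := ((hD (l := 0) (k := K) (by omega)).pow_smul 1).pow_mono (m := K + 1) (by omega)
    refine (h1.sub h2).congr_left fun h => ?_
    rw [nextVel]
    simp only [pow_zero, pow_one, smul_sub, Finset.sum_sub_distrib, mul_one]
    abel

end RKN

/-! ### From the continuous-stage conditions to the discrete ones -/

section Discretization

theorem QuadratureOrder.moment {s p n : ℕ} {b c : Fin s → ℝ} (h : QuadratureOrder b c p)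
    (hn : n < p) : ∑ i, b i * c i ^ n = 1 / ((n : ℝ) + 1) := by
  have := h (Polynomial.X ^ n) (by rw [Polynomial.degree_X_pow]; exact_mod_cast hn)
  simpa using this

/-- If the `τ`-moments of a sum of terms `a τ^u σ^w` are given for `σ ∈ [0, 1]` by a polynomial, then
so are the moments computed by a quadrature formula, for every `σ`. -/
theorem QuadratureOrder.sum_eq_eval {ι : Type*} (I : Finset ι) (a : ι → ℝ) (u w : ι → ℕ)
    {s p l : ℕ} {b c : Fin s → ℝ} (h : QuadratureOrder b c p) (hu : ∀ i ∈ I, l + u i < p)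
    (R : Polynomial ℝ) (hR : ∀ σ ∈ Set.Icc (0 : ℝ) 1,
      ∫ τ in (0 : ℝ)..1, τ ^ l * ∑ i ∈ I, a i * (τ ^ u i * σ ^ w i) = R.eval σ) (σ : ℝ) :
    ∑ j, b j * (c j ^ l * ∑ i ∈ I, a i * (c j ^ u i * σ ^ w i)) = R.eval σ := by
  let P : Polynomial ℝ := ∑ i ∈ I,
    Polynomial.C (a i * (1 / (((l + u i : ℕ) : ℝ) + 1))) * Polynomial.X ^ w i
  -- Agreement on `[0, 1]` is a polynomial identity, so it also holds at nodes outside the interval.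
  have hP : P = R := by
    refine Polynomial.eq_of_infinite_eval_eq _ _ ((Set.Icc_infinite one_pos).mono fun σ hσ => ?_)
    rw [Set.mem_ofPred_eq, ← hR σ hσ, Polynomial.eval_finsetSum]
    simp_rw [Finset.mul_sum]
    rw [intervalIntegral.integral_finsetSum
      fun i _ => Continuous.intervalIntegrable (by fun_prop) _ _]
    refine Finset.sum_congr rfl fun i _ => ?_
    have : (fun τ : ℝ => τ ^ l * (a i * (τ ^ u i * σ ^ w i)))
        = fun τ => (a i * σ ^ w i) * τ ^ (l + u i) := by
      ext τ; ring
    rw [this, intervalIntegral.integral_const_mul, integral_pow]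
    simp
    ring
  rw [← hP, Polynomial.eval_finsetSum]
  simp_rw [Finset.mul_sum]
  rw [Finset.sum_comm]
  refine Finset.sum_congr rfl fun i hi => ?_
  simp only [Polynomial.eval_mul, Polynomial.eval_C, Polynomial.eval_pow, Polynomial.eval_X]
  rw [← h.moment (hu i hi), Finset.mul_sum, Finset.sum_mul]
  exact Finset.sum_congr rfl fun j _ => by ring

theorem MvPolynomial.eval_fin_two (A : MvPolynomial (Fin 2) ℝ) (τ σ : ℝ) :
    MvPolynomial.eval ![τ, σ] A = ∑ m ∈ A.support, A.coeff m * (τ ^ m 0 * σ ^ m 1) := by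
  rw [MvPolynomial.eval_eq']
  simp [Fin.prod_univ_two]

end Discretization

/-- With `κ = m + 1` in CN and `κ = l + 1` in DN, the integrands have degree at most `m + dσ` in
`σ`, respectively `l + dτ` in `τ`; below `p` the quadrature is exact on them. -/
theorem CSRKN.simplifying_discretize (M : CSRKN) (A : MvPolynomial (Fin 2) ℝ)
    {s p η ζ a d : ℕ} {b c : Fin s → ℝ} (hquad : QuadratureOrder b c p)
    {S : Set ℝ} (hS : Set.Icc (0 : ℝ) 1 ⊆ S) (hcS : ∀ i, c i ∈ S)
    (hA : ∀ τ ∈ S, ∀ σ ∈ S, M.Abar τ σ = MvPolynomial.eval ![τ, σ] A)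
    (hBbar : ∀ τ ∈ S, M.Bbar τ = M.B τ * (1 - M.C τ))
    (hB : ∀ τ ∈ S, M.B τ = 1) (hC : ∀ τ ∈ S, M.C τ = τ) (hCN : M.CN η) (hDN : M.DN ζ)
    (ha : ∀ m < a, m + 2 ≤ η ∧ m + A.degreeOf 1 < p)
    (hd : ∀ l < d, l + 2 ≤ ζ ∧ l + A.degreeOf 0 < p) :
    (M.discretize b c).Simplifying p a d := by
  refine ⟨fun n hn => ?_, fun m hm i => ?_, fun l hl j => ?_, fun i => ?_⟩
  · simpa [discretize, hB _ (hcS _), hC _ (hcS _)] using hquad.moment hn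
  · obtain ⟨hη, hp⟩ := ha m hm
    let R : Polynomial ℝ :=
      Polynomial.C (1 / (((m : ℝ) + 1) * ((m : ℝ) + 2))) * Polynomial.X ^ (m + 2)
    have hR (x : ℝ) : R.eval x = x ^ (m + 2) / (((m : ℝ) + 1) * ((m : ℝ) + 2)) := by
      simp only [R, Polynomial.eval_mul, Polynomial.eval_C, Polynomial.eval_pow, Polynomial.eval_X]
      ring
    have key := hquad.sum_eq_eval (l := m) A.support A.coeff (fun n => n 1) (fun n => n 0)
      (fun n hn => lt_of_le_of_lt (Nat.add_le_add_left
        (MvPolynomial.monomial_le_degreeOf 1 hn) m) hp) R (fun τ hτ => ?_) (c i)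
    · simp only [discretize, Matrix.of_apply, hC _ (hcS _), hA _ (hcS _) _ (hcS _),
        MvPolynomial.eval_fin_two]
      refine Eq.trans (Finset.sum_congr rfl fun j _ => ?_) (key.trans (hR _))
      simp only [mul_comm (c j ^ _) (c i ^ _)]
      ring
    · have h1 := hCN (m + 1) (by omega) (by omega) τ hτ
      rw [hC τ (hS hτ)] at h1
      refine Eq.trans (intervalIntegral.integral_congr fun σ hσ => ?_) (h1.trans ?_)
      · rw [Set.uIcc_of_le zero_le_one] at hσ
        simp only [hA τ (hS hτ) σ (hS hσ), hC σ (hS hσ), MvPolynomial.eval_fin_two,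
          Nat.add_sub_cancel]
        simp only [mul_comm (σ ^ _) (τ ^ _)]
        ring
      · rw [hR]
        push_cast
        ring
  · obtain ⟨hζ, hp⟩ := hd l hl
    let R : Polynomial ℝ :=
      Polynomial.C (1 / (((l : ℝ) + 1) * ((l : ℝ) + 2))) * Polynomial.X ^ (l + 2)
        - Polynomial.C (1 / ((l : ℝ) + 1)) * Polynomial.X + Polynomial.C (1 / ((l : ℝ) + 2))
    have hR (x : ℝ) : R.eval x = x ^ (l + 2) / (((l : ℝ) + 1) * ((l : ℝ) + 2))
        - x / ((l : ℝ) + 1) + 1 / ((l : ℝ) + 2) := by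
      simp only [R, Polynomial.eval_mul, Polynomial.eval_C, Polynomial.eval_pow,
        Polynomial.eval_X, Polynomial.eval_add, Polynomial.eval_sub]
      ring
    have key := hquad.sum_eq_eval (l := l) A.support A.coeff (fun n => n 0) (fun n => n 1)
      (fun n hn => lt_of_le_of_lt (Nat.add_le_add_left
        (MvPolynomial.monomial_le_degreeOf 0 hn) l) hp) R (fun σ hσ => ?_) (c j)
    · simp only [discretize, Matrix.of_apply, hC _ (hcS _), hB _ (hcS _),
        hA _ (hcS _) _ (hcS _), MvPolynomial.eval_fin_two, mul_one]
      rw [← hR, ← key, Finset.mul_sum]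
      exact Finset.sum_congr rfl fun i _ => by ring
    · have h1 := hDN (l + 1) (by omega) (by omega) σ hσ
      rw [hC σ (hS hσ), hB σ (hS hσ)] at h1
      refine Eq.trans (intervalIntegral.integral_congr fun τ hτ => ?_) (h1.trans ?_)
      · rw [Set.uIcc_of_le zero_le_one] at hτ
        simp only [hA τ (hS hτ) σ (hS hσ), hC τ (hS hτ), hB τ (hS hτ),
          MvPolynomial.eval_fin_two, Nat.add_sub_cancel, one_mul]
      · rw [hR]
        push_cast
        ring
  · simp [discretize, hB _ (hcS _), hC _ (hcS _), hBbar _ (hcS _)]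

/-- `S` is the domain on which the coefficient functions are given: it contains `[0, 1]` and the
nodes (`S = [0, 1]` when all the nodes lie there). An order bound that is negative is read as `0`. -/
theorem mainTheorem3 (M : CSRKN) (A : MvPolynomial (Fin 2) ℝ) (dτ dσ : ℕ)
    (hdτ : A.degreeOf 0 = dτ) (hdσ : A.degreeOf 1 = dσ)
    (s p η ζ : ℕ) (b c : Fin s → ℝ) (hquad : QuadratureOrder b c p)
    (S : Set ℝ) (hS : Set.Icc (0 : ℝ) 1 ⊆ S) (hcS : ∀ i, c i ∈ S)
    (hA : ∀ τ ∈ S, ∀ σ ∈ S, M.Abar τ σ = MvPolynomial.eval ![τ, σ] A)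
    (hBbar : ∀ τ ∈ S, M.Bbar τ = M.B τ * (1 - M.C τ))
    (hB : ∀ τ ∈ S, M.B τ = 1) (hC : ∀ τ ∈ S, M.C τ = τ)
    (hCN : M.CN η) (hDN : M.DN ζ)
    (α β : ℤ) (hα : α = min (η : ℤ) ((p : ℤ) - dσ + 1)) (hβ : β = min (ζ : ℤ) ((p : ℤ) - dτ + 1)) :
    (M.discretize b c).HasOrder (min (p : ℤ) (min (2 * α + 2) (α + β))).toNat :=
  -- `m < α - 1` says precisely `m + 2 ≤ η` and `m + dσ < p`, and similarly for `β`. Truncation at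
  -- `0` is harmless, since it only enlarges `2a + 4` and `a + d + 2`.
  (M.simplifying_discretize A (a := (α - 1).toNat) (d := (β - 1).toNat) hquad hS hcS hA hBbar hB hC
    hCN hDN (fun m hm => by omega) (fun l hl => by omega)).hasOrder
    (by omega) (by omega) (by omega)
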